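/- Let $G=(V,E)$ be a finite connected graph, possibly with parallel edges and loops. Let $\mathbb E$ be the set of oriented edges: each edge gives two oriented edges $e,\bar e$ in opposite directions. Let $C^1(G,\mathbb R)$ be the space of functions $x:\mathbb E\to\mathbb R$ with $x_{\bar e}=-x_e$, with the quadratic form $q(x)=\sum x_e^2$, where the sum takes one of $e,\bar e$ for each edge. For $f:V\to\mathbb R$ let $d(f)\in C^1(G,\mathbb R)$ be given by $d(f)_e=f(\text{head of }e)-f(\text{tail of }e)$. Let $\mathrm K=d(\mathbb R^V)$ be the cut space and $L=d(\mathbb Z^V)\subset \mathrm K$ the lattice of integer cuts. The covering number $\mathrm{Cov}(L)$ is the smallest real number $r$ such that for every $x\in \mathrm K$ there is $m\in L$ with $q(x-m)\le r$. Let $\Delta$ be the Laplacian, $\Delta(f)(y)=\sum (f(y)-f(z))$, the sum being over all edges joining $y$ to a vertex $z$ (with multiplicity), and $\langle f,g\rangle=\sum_{y\in V} f(y)g(y)$. An acyclic orientation $D$ of $G$ is a choice of one of the two directions for every edge that is not a loop, such that there is no oriented cycle (loops, which play no role for cuts, are left unoriented). Write $d^{\mathrm{in}}_y,d^{\mathrm{out}}_y$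 for the in- and out-degrees in $D$. For every acyclic orientation $D$ the equation $2\Delta(f_D)=d^{\mathrm{in}}-d^{\mathrm{out}}$ has a solution $f_D:V\to\mathbb R$, and $\langle f_D,\Delta(f_D)\rangle$ does not depend on the solution. An acyclic orientation $D$ of $G$ is called well-unbalanced if it maximizes $\langle f_D,\Delta(f_D)\rangle$ among all acyclic orientations of $G$; such orientations exist. Then for every well-unbalanced acyclic orientation $D$ of $G$, $$\mathrm{Cov}(L)=\langle f_D,\Delta(f_D)\rangle .$$ In particular, if $G$ is bipartite, then $\mathrm{Cov}(L)=\frac{|E|}{4}$. -/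

import Mathlib

/-- A graph with vertex set `V`, possibly with parallel edges and loops, given by its set `A` of
oriented edges: every edge gives two oriented edges `e` and `bar e` in opposite directions. -/
structure OrGraph (V A : Type*) where
  tail : A → V
  head : A → V
  bar : A → A
  bar_bar : ∀ e, bar (bar e) = e
  bar_ne : ∀ e, bar e ≠ e
  tail_bar : ∀ e, tail (bar e) = head e

/-- `r` is the covering number of the lattice `L` in the real vector space `E` with quadratic form
`q`: the smallest real number such that every point `x` has a lattice point `m` with
`q (x - m) ≤ r`. -/
def IsCoveringNumber {E : Type*} [AddCommGroup E] [Module ℝ E] (q : QuadraticForm ℝ E)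
    (L : AddSubgroup E) (r : ℝ) : Prop :=
  IsLeast {r : ℝ | ∀ x : E, ∃ m ∈ L, q (x - m) ≤ r} r

namespace OrGraph

variable {V A : Type*} (G : OrGraph V A)

theorem head_bar (e : A) : G.head (G.bar e) = G.tail e := by
  rw [← G.tail_bar, G.bar_bar]

/-- Any two vertices are joined by a path (and there is a vertex). -/
def Connected : Prop :=
  Nonempty V ∧ ∀ u v : V, Relation.ReflTransGen (fun x y => ∃ e, G.tail e = x ∧ G.head e = y) u v

/-- The vertices split into two classes such that every edge joins the two classes. -/
def Bipartite : Prop :=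
  ∃ X : Set V, ∀ e, G.tail e ∈ X ↔ G.head e ∉ X

/-- The number of (unoriented) edges: an edge is an unordered pair `{e, bar e}`. -/
noncomputable def numEdges : ℕ := (Set.range fun e => s(e, G.bar e)).ncard

/-- `C¹(G, R)`: functions on oriented edges with `g (bar e) = - g e`. -/
def C1 (R : Type*) [CommRing R] : Submodule R (A → R) where
  carrier := {g | ∀ e, g (G.bar e) = - g e}
  add_mem' := by
    intro a b ha hb e
    simp only [Pi.add_apply, ha e, hb e]
    ring
  zero_mem' := by
    intro e
    simp
  smul_mem' := by
    intro c a ha e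
    simp [ha e]

/-- The differential `d : C⁰(G, R) → C¹(G, R)`, `d f e = f (head e) - f (tail e)`. -/
def d (R : Type*) [CommRing R] : (V → R) →ₗ[R] G.C1 R where
  toFun f := ⟨fun e => f (G.head e) - f (G.tail e), fun e => by
    simp only [G.head_bar, G.tail_bar, neg_sub]⟩
  map_add' f g := by
    ext e
    simp only [Pi.add_apply, Submodule.coe_add]
    ring
  map_smul' c f := by
    ext e
    simp only [Pi.smul_apply, smul_eq_mul, RingHom.id_apply, Submodule.coe_smul]
    ring

theorem d_apply (R : Type*) [CommRing R] (f : V → R) (e : A) :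
    (G.d R f).1 e = f (G.head e) - f (G.tail e) := rfl

/-- The inclusion of `C¹(G, ℤ)` in `C¹(G, ℝ)`. -/
def castC1 : G.C1 ℤ →+ G.C1 ℝ where
  toFun g := ⟨fun e => (g.1 e : ℝ), fun e => by
    have h := g.2 e
    simp only [h, Int.cast_neg]⟩
  map_zero' := by
    ext e
    simp
  map_add' g h := by
    ext e
    simp

theorem castC1_apply (g : G.C1 ℤ) (e : A) : (G.castC1 g).1 e = (g.1 e : ℝ) := rfl

/-- The real cut space `K = im (d : C⁰(G, ℝ) → C¹(G, ℝ))`. -/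
def cutSpace : Submodule ℝ (G.C1 ℝ) := LinearMap.range (G.d ℝ)

/-- The image of `d : C⁰(G, ℤ) → C¹(G, ℤ)`, inside `C¹(G, ℝ)`. -/
def integerCuts : AddSubgroup (G.C1 ℝ) := (LinearMap.range (G.d ℤ)).toAddSubgroup.map G.castC1

theorem integerCuts_le : G.integerCuts ≤ G.cutSpace.toAddSubgroup := by
  rintro _ ⟨_, ⟨f, rfl⟩, rfl⟩
  refine ⟨fun v => (f v : ℝ), ?_⟩
  ext e
  simp [d, castC1]

/-- The lattice of integer cuts, as a subgroup of the cut space (in which `integerCuts` is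
contained). -/
def cutLattice : AddSubgroup G.cutSpace := G.integerCuts.addSubgroupOf G.cutSpace.toAddSubgroup

section Finite

variable [Fintype A]

/-- The inner product on `C¹(G, ℝ)` for which the unoriented edges, each with an arbitrary
direction, form an orthonormal basis; the factor `1 / 2` is there because every unoriented edge
occurs twice in the sum. -/
noncomputable def edgeInner : LinearMap.BilinForm ℝ (G.C1 ℝ) :=
  LinearMap.mk₂ ℝ (fun x y => (1 / 2 : ℝ) * ∑ e, x.1 e * y.1 e)
    (fun x x' y => by
      simp only [Submodule.coe_add, Pi.add_apply, add_mul, Finset.sum_add_distrib, mul_add])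
    (fun c x y => by
      simp only [Submodule.coe_smul, Pi.smul_apply, smul_eq_mul, Finset.mul_sum]
      exact Finset.sum_congr rfl fun e _ => by ring)
    (fun x y y' => by
      simp only [Submodule.coe_add, Pi.add_apply, Finset.sum_add_distrib, mul_add])
    (fun c x y => by
      simp only [Submodule.coe_smul, Pi.smul_apply, smul_eq_mul, Finset.mul_sum]
      exact Finset.sum_congr rfl fun e _ => by ring)

/-- The quadratic form `q x = ⟨x, x⟩` restricted to the cut space. -/
noncomputable def cutForm : QuadraticForm ℝ G.cutSpace :=
  (LinearMap.BilinMap.toQuadraticMap G.edgeInner).comp G.cutSpace.subtype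

/-- The graph Laplacian: `Δ f y` is the sum of `f y - f z` over all edges from `y` to `z`. -/
def laplacian [DecidableEq V] (f : V → ℝ) (y : V) : ℝ :=
  ∑ e with G.tail e = y, (f y - f (G.head e))

/-- The quantity `⟨f, Δ f⟩`. -/
def energy [Fintype V] [DecidableEq V] (f : V → ℝ) : ℝ := ∑ y, f y * G.laplacian f y

end Finite

/-- `D` is an acyclic orientation of the graph: it contains exactly one of `e` and `bar e` for
every edge which is not a loop, and no oriented cycle (no closed directed walk of positive length).
In particular it contains no loops: loops are left unoriented, as they play no role for cuts. -/
def IsAcyclicOrientation (D : Finset A) : Prop :=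
  (∀ e, G.tail e ≠ G.head e → (G.bar e ∈ D ↔ e ∉ D)) ∧
  ∀ v, ¬ Relation.TransGen (fun x y => ∃ e ∈ D, G.tail e = x ∧ G.head e = y) v v

/-- The in-degree of `y` in `D`. -/
def inDeg [DecidableEq V] (D : Finset A) (y : V) : ℕ := {e ∈ D | G.head e = y}.card

/-- The out-degree of `y` in `D`. -/
def outDeg [DecidableEq V] (D : Finset A) (y : V) : ℕ := {e ∈ D | G.tail e = y}.card

/-- `f` is a solution `f_D` of the Laplacian equation `2 Δ f = d^in - d^out`. -/
def IsPotential [Fintype A] [DecidableEq V] (D : Finset A) (f : V → ℝ) : Prop :=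
  ∀ y, 2 * G.laplacian f y = (G.inDeg D y : ℝ) - (G.outDeg D y : ℝ)

/-- The acyclic orientation `D` is well-unbalanced: it maximizes `⟨f_D, Δ f_D⟩` among all acyclic
orientations. -/
def IsWellUnbalanced [Fintype V] [Fintype A] [DecidableEq V] (D : Finset A) : Prop :=
  G.IsAcyclicOrientation D ∧ ∃ f, G.IsPotential D f ∧
    ∀ D' f', G.IsAcyclicOrientation D' → G.IsPotential D' f' → G.energy f' ≤ G.energy f

end OrGraph

namespace OrGraph

variable {V A : Type*} (G : OrGraph V A)

/-! The covering number is the largest norm of a point of the Voronoi cell of the origin. By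
summation by parts, a potential `f` of `D` satisfies `2⟨df, dg⟩ = ∑_{e ∈ D} dg_e` for all `g`: `df`
is the orthogonal projection to the cut space of half the indicator of `D`.

Lower bound (`IsPotential.dirichlet_self_le`): as `k ≤ k²` for integers, no integer cut is closer to
`df_D` than `0`.

Upper bound (`exists_dirichlet_self_le_energy`): if `df` is in the Voronoi cell, comparison with
indicators of vertex sets bounds its pairing with every cut, and slicing `f` into level sets gives
`2q(df) ≤ ∑ |df_e|`, one term per edge. For `D` acyclic with `f` nondecreasing along it, the right
side is `2⟨df_D, df⟩`, hence `q(df) ≤ q(df_D)`. -/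

theorem sum_mul_inDeg_sub_outDeg [Fintype V] [DecidableEq V] (D : Finset A) (g : V → ℝ) :
    ∑ y, g y * ((G.inDeg D y : ℝ) - (G.outDeg D y : ℝ)) =
      ∑ e ∈ D, (g (G.head e) - g (G.tail e)) := by
  have key : ∀ t : A → V, ∑ y, g y * (({e ∈ D | t e = y}.card : ℕ) : ℝ) = ∑ e ∈ D, g (t e) := by
    intro t
    rw [← Finset.sum_fiberwise D t]
    refine Finset.sum_congr rfl fun y _ => ?_
    rw [Finset.sum_congr rfl fun e he => by rw [(Finset.mem_filter.1 he).2],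
      Finset.sum_const, nsmul_eq_mul, mul_comm]
  simp only [mul_sub, Finset.sum_sub_distrib]
  rw [← key G.head, ← key G.tail]
  rfl

theorem mem_cutLattice {m : G.cutSpace} :
    m ∈ G.cutLattice ↔ ∃ n : V → ℤ, m.1 = G.d ℝ fun v => (n v : ℝ) := by
  have hd : ∀ n : V → ℤ, G.castC1 (G.d ℤ n) = G.d ℝ fun v => (n v : ℝ) := by
    intro n
    ext e
    simp [castC1_apply, d_apply]
  change m.1 ∈ G.integerCuts ↔ _
  constructor
  · rintro ⟨_, ⟨n, rfl⟩, h⟩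
    exact ⟨n, by rw [← h, hd]⟩
  · rintro ⟨n, h⟩
    exact ⟨_, ⟨n, rfl⟩, by rw [h, hd]⟩

/-! ### The Dirichlet form and summation by parts -/

section Pairing

variable [Fintype A]

/-- The inner product of the differentials of two functions on the vertices. -/
noncomputable def dirichlet (f g : V → ℝ) : ℝ :=
  (1 / 2 : ℝ) * ∑ e, (f (G.head e) - f (G.tail e)) * (g (G.head e) - g (G.tail e))

theorem dirichlet_comm (f g : V → ℝ) : G.dirichlet f g = G.dirichlet g f := by
  simp only [dirichlet, mul_comm]

theorem dirichlet_add_right (f g g' : V → ℝ) :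
    G.dirichlet f (g + g') = G.dirichlet f g + G.dirichlet f g' := by
  simp only [dirichlet, ← mul_add, ← Finset.sum_add_distrib, Pi.add_apply]
  congr 1
  exact Finset.sum_congr rfl fun e _ => by ring

theorem dirichlet_smul_right (f g : V → ℝ) (c : ℝ) :
    G.dirichlet f (c • g) = c * G.dirichlet f g := by
  simp only [dirichlet, Finset.mul_sum, Pi.smul_apply, smul_eq_mul]
  exact Finset.sum_congr rfl fun e _ => by ring

theorem dirichlet_sub_self (f g : V → ℝ) :
    G.dirichlet (f - g) (f - g) =
      G.dirichlet f f - 2 * G.dirichlet f g + G.dirichlet g g := by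
  simp only [dirichlet, Finset.mul_sum, Pi.sub_apply, ← Finset.sum_sub_distrib,
    ← Finset.sum_add_distrib]
  exact Finset.sum_congr rfl fun e _ => by ring

theorem dirichlet_self_nonneg (f : V → ℝ) : 0 ≤ G.dirichlet f f :=
  mul_nonneg (by norm_num) (Finset.sum_nonneg fun _ _ => mul_self_nonneg _)

theorem sum_comp_bar (w : A → ℝ) : ∑ e, w (G.bar e) = ∑ e, w e :=
  Equiv.sum_comp (Function.Involutive.toPerm G.bar G.bar_bar) w

/-- Summation by parts. -/
theorem sum_mul_laplacian [Fintype V] [DecidableEq V] (f g : V → ℝ) :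
    ∑ y, f y * G.laplacian g y = G.dirichlet f g := by
  have h : ∑ y, f y * G.laplacian g y =
      ∑ e, f (G.tail e) * (g (G.tail e) - g (G.head e)) := by
    rw [← Finset.sum_fiberwise Finset.univ G.tail]
    refine Finset.sum_congr rfl fun y _ => ?_
    rw [laplacian, Finset.mul_sum]
    refine Finset.sum_congr rfl fun e he => ?_
    rw [(Finset.mem_filter.1 he).2]
  have h' := G.sum_comp_bar fun e => f (G.tail e) * (g (G.tail e) - g (G.head e))
  simp only [G.tail_bar, G.head_bar] at h'
  have h2 : ∑ e, (f (G.head e) - f (G.tail e)) * (g (G.head e) - g (G.tail e)) =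
      ∑ e, f (G.head e) * (g (G.head e) - g (G.tail e)) +
      ∑ e, f (G.tail e) * (g (G.tail e) - g (G.head e)) := by
    rw [← Finset.sum_add_distrib]
    exact Finset.sum_congr rfl fun e _ => by ring
  rw [dirichlet, h2, h', h]
  ring

theorem energy_eq_dirichlet [Fintype V] [DecidableEq V] (f : V → ℝ) :
    G.energy f = G.dirichlet f f :=
  G.sum_mul_laplacian f f

theorem IsPotential.dirichlet_eq [Fintype V] [DecidableEq V] {D : Finset A} {f : V → ℝ}
    (hf : G.IsPotential D f) (g : V → ℝ) :
    2 * G.dirichlet f g = ∑ e ∈ D, (g (G.head e) - g (G.tail e)) := by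
  rw [← sum_mul_inDeg_sub_outDeg, dirichlet_comm, ← sum_mul_laplacian, Finset.mul_sum]
  refine Finset.sum_congr rfl fun y _ => ?_
  rw [← hf y]
  ring

/-- Both potentials pair equally with every function, in particular with each other. -/
theorem energy_eq_of_isPotential [Fintype V] [DecidableEq V] {D : Finset A} {f f' : V → ℝ}
    (hf : G.IsPotential D f) (hf' : G.IsPotential D f') : G.energy f = G.energy f' := by
  have h1 := hf.dirichlet_eq G f
  have h2 := hf'.dirichlet_eq G f
  have h3 := hf.dirichlet_eq G f'
  have h4 := hf'.dirichlet_eq G f'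
  have h5 := G.dirichlet_comm f f'
  rw [energy_eq_dirichlet, energy_eq_dirichlet]
  linarith

/-! ### Solvability of the Laplacian equation -/

/-- The Laplacian as a linear map. -/
def laplacianHom [DecidableEq V] : (V → ℝ) →ₗ[ℝ] (V → ℝ) where
  toFun := G.laplacian
  map_add' f g := by
    ext y
    simp only [laplacian, Pi.add_apply, ← Finset.sum_add_distrib]
    exact Finset.sum_congr rfl fun e _ => by ring
  map_smul' c f := by
    ext y
    simp only [laplacian, Pi.smul_apply, smul_eq_mul, RingHom.id_apply, Finset.mul_sum]
    exact Finset.sum_congr rfl fun e _ => by ring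

theorem eq_of_dirichlet_self_eq_zero {f : V → ℝ} (hf : G.dirichlet f f = 0) (e : A) :
    f (G.head e) = f (G.tail e) := by
  have h : ∑ e, (f (G.head e) - f (G.tail e)) * (f (G.head e) - f (G.tail e)) = 0 := by
    rw [dirichlet] at hf
    linarith
  have := (Finset.sum_eq_zero_iff_of_nonneg fun e _ => mul_self_nonneg _).1 h e (Finset.mem_univ e)
  exact sub_eq_zero.1 (mul_self_eq_zero.1 this)

/-- Fredholm alternative: a functional `c` vanishing on the range of `Δ` has `⟨c, Δ c⟩ = 0`, so it
is constant along edges and also kills in-degree minus out-degree. -/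
theorem exists_isPotential [Fintype V] [DecidableEq V] (D : Finset A) :
    ∃ f, G.IsPotential D f := by
  set b : V → ℝ := fun y => (G.inDeg D y : ℝ) - (G.outDeg D y : ℝ) with hb
  suffices h : b ∈ LinearMap.range G.laplacianHom by
    obtain ⟨f, hf⟩ := h
    refine ⟨(1 / 2 : ℝ) • f, fun y => ?_⟩
    have h1 : G.laplacian ((1 / 2 : ℝ) • f) = (1 / 2 : ℝ) • b := by
      rw [← hf]
      exact G.laplacianHom.map_smul _ f
    rw [h1, Pi.smul_apply, smul_eq_mul, hb]
    ring
  by_contra hn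
  obtain ⟨φ, hφ, hle⟩ := Submodule.exists_le_ker_of_notMem hn
  set c : V → ℝ := fun y => φ (Pi.single y 1)
  have hφc : ∀ g : V → ℝ, φ g = ∑ y, c y * g y := by
    intro g
    conv_lhs => rw [← Finset.univ_sum_single g, map_sum]
    refine Finset.sum_congr rfl fun y _ => ?_
    rw [mul_comm, ← smul_eq_mul, ← map_smul, ← Pi.single_smul, smul_eq_mul, mul_one]
  have hc : G.dirichlet c c = 0 := by
    rw [← sum_mul_laplacian, ← hφc]
    exact hle ⟨c, rfl⟩
  apply hφ
  rw [hφc, hb, sum_mul_inDeg_sub_outDeg]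
  exact Finset.sum_eq_zero fun e _ => by
    rw [G.eq_of_dirichlet_self_eq_zero hc e, sub_self]

/-! ### Orientations and the Voronoi cell -/

/-- A symmetric function on the oriented edges which vanishes on loops sums to twice its sum over
an orientation. -/
theorem IsAcyclicOrientation.sum_eq {D : Finset A} (hD : G.IsAcyclicOrientation D) {w : A → ℝ}
    (hbar : ∀ e, w (G.bar e) = w e) (hloop : ∀ e, G.tail e = G.head e → w e = 0) :
    ∑ e, w e = 2 * ∑ e ∈ D, w e := by
  classical
  have h1 : ∑ e ∈ D, w e = ∑ e, if e ∈ D then w e else 0 := by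
    rw [← Finset.sum_filter, Finset.filter_mem_eq_inter, Finset.univ_inter]
  have h2 := G.sum_comp_bar fun e => if e ∈ D then w e else 0
  rw [two_mul, h1]
  -- One copy is reindexed by `bar`, so that at each non-loop `e` exactly one of the two terms
  -- survives.
  nth_rewrite 1 [← h2]
  rw [← Finset.sum_add_distrib]
  refine Finset.sum_congr rfl fun e _ => ?_
  by_cases he : G.tail e = G.head e
  · simp [hbar, hloop e he]
  · by_cases hm : e ∈ D <;> simp [hbar, hD.1 e he, hm]

theorem IsAcyclicOrientation.dirichlet_self_eq {D : Finset A} (hD : G.IsAcyclicOrientation D)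
    (f : V → ℝ) :
    G.dirichlet f f = ∑ e ∈ D, (f (G.head e) - f (G.tail e)) ^ 2 := by
  have h := hD.sum_eq G (w := fun e => (f (G.head e) - f (G.tail e)) ^ 2)
    (fun e => by simp only [G.head_bar, G.tail_bar]; ring) (fun e he => by simp [he])
  simp only [dirichlet, ← pow_two, h]
  ring

/-- The differential of a potential of an orientation lies in the Voronoi cell of the origin. -/
theorem IsPotential.dirichlet_self_le [Fintype V] [DecidableEq V] {D : Finset A} {f : V → ℝ}
    (hf : G.IsPotential D f) (hD : G.IsAcyclicOrientation D) (n : V → ℤ) :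
    G.dirichlet f f ≤ G.dirichlet (f - fun v => (n v : ℝ)) (f - fun v => (n v : ℝ)) := by
  have h1 := hf.dirichlet_eq G fun v => (n v : ℝ)
  have h2 : ∑ e ∈ D, ((n (G.head e) : ℝ) - n (G.tail e)) ≤
      ∑ e ∈ D, ((n (G.head e) : ℝ) - n (G.tail e)) ^ 2 :=
    Finset.sum_le_sum fun e _ => by
      exact_mod_cast Int.le_self_sq (n (G.head e) - n (G.tail e))
  rw [dirichlet_sub_self, h1, hD.dirichlet_self_eq G fun v => (n v : ℝ)]
  linarith

/-- Layer cake: an inequality for cuts extends to all nonnegative functions on the vertices. -/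
theorem two_mul_dirichlet_le_of_nonneg [Fintype V] {f : V → ℝ}
    (hf : ∀ S : Set V, 2 * G.dirichlet f (S.indicator 1) ≤
      (1 / 2 : ℝ) * ∑ e, |S.indicator (1 : V → ℝ) (G.head e) - S.indicator 1 (G.tail e)|)
    (g : V → ℝ) (hg : 0 ≤ g) :
    2 * G.dirichlet f g ≤ (1 / 2 : ℝ) * ∑ e, |g (G.head e) - g (G.tail e)| := by
  induction hk : g.support.ncard using Nat.strong_induction_on generalizing g with
  | _ k ih =>
    rcases g.support.eq_empty_or_nonempty with h0 | hne
    · rw [Function.support_eq_empty_iff] at h0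
      simp [h0, dirichlet]
    obtain ⟨v, hv, hmin⟩ := Set.exists_min_image _ g g.support.toFinite hne
    set S := g.support with hS
    have hc : 0 < g v := lt_of_le_of_ne (hg v) (Ne.symm hv)
    -- Peels off the bottom layer: `g v` is the least positive value, so `g'` stays nonnegative and
    -- loses `v` from its support.
    set g' : V → ℝ := g - g v • S.indicator 1 with hg'
    have hin : ∀ y ∈ S, g' y = g y - g v := fun y hy => by simp [hg', hy]
    have hout : ∀ y ∉ S, g' y = 0 := fun y hy => by
      simp [hg', hy, Function.notMem_support.1 hy]
    have hpos : 0 ≤ g' := fun y => by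
      by_cases hy : y ∈ S
      · simpa [hin y hy] using hmin y hy
      · simp [hout y hy]
    have hlt : g'.support.ncard < k := by
      rw [← hk]
      refine Set.ncard_lt_ncard ⟨fun y hy => ?_, fun h => ?_⟩
      · by_contra hyS
        exact hy (hout y hyS)
      · exact h hv (by rw [hin v hv, sub_self])
    have key := ih _ hlt g' hpos rfl
    have hgg : g = g' + g v • S.indicator 1 := by simp [hg']
    have habs : ∀ e, |g (G.head e) - g (G.tail e)| = |g' (G.head e) - g' (G.tail e)| +
        g v * |S.indicator (1 : V → ℝ) (G.head e) - S.indicator 1 (G.tail e)| := by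
      intro e
      by_cases h1 : G.head e ∈ S <;> by_cases h2 : G.tail e ∈ S
      · simp [hin _ h1, hin _ h2, h1, h2]
      · have := hmin _ h1
        rw [hin _ h1, hout _ h2, Function.notMem_support.1 h2]
        simp only [h1, h2, Set.indicator_of_mem, Set.indicator_of_notMem, not_false_eq_true,
          Pi.one_apply, sub_zero, abs_one, mul_one]
        rw [abs_of_nonneg (hg _), abs_of_nonneg (by linarith)]
        ring
      · have := hmin _ h2
        rw [hin _ h2, hout _ h1, Function.notMem_support.1 h1]
        simp only [h1, h2, Set.indicator_of_mem, Set.indicator_of_notMem, not_false_eq_true,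
          Pi.one_apply, zero_sub, abs_neg, abs_one, mul_one]
        rw [abs_of_nonneg (hg _), abs_of_nonneg (by linarith)]
        ring
      · rw [hout _ h1, hout _ h2, Function.notMem_support.1 h1, Function.notMem_support.1 h2]
        simp [h1, h2]
    have hcut := mul_le_mul_of_nonneg_left (hf S) hc.le
    have hd : G.dirichlet f g = G.dirichlet f g' + g v * G.dirichlet f (S.indicator 1) := by
      conv_lhs => rw [hgg]
      rw [dirichlet_add_right, dirichlet_smul_right]
    rw [hd]
    simp only [habs, Finset.sum_add_distrib, ← Finset.mul_sum]
    linarith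

/-- For the differential of `f` in the Voronoi cell of the origin, the inequalities for the cuts
bound the energy of `f`. -/
theorem two_mul_dirichlet_self_le [Fintype V] {f : V → ℝ}
    (hf : ∀ n : V → ℤ, G.dirichlet f f ≤
      G.dirichlet (f - fun v => (n v : ℝ)) (f - fun v => (n v : ℝ))) :
    2 * G.dirichlet f f ≤ (1 / 2 : ℝ) * ∑ e, |f (G.head e) - f (G.tail e)| := by
  obtain ⟨c, hc⟩ : ∃ c : ℝ, ∀ v, c ≤ f v := by
    obtain ⟨c, hc⟩ := (Set.finite_range f).bddBelow
    exact ⟨c, fun v => hc ⟨v, rfl⟩⟩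
  -- Subtracting a lower bound makes `f` nonnegative without changing its differential.
  have key := G.two_mul_dirichlet_le_of_nonneg (f := f) (fun S => ?_) (fun v => f v - c)
    (fun v => sub_nonneg.2 (hc v))
  · simpa [dirichlet] using key
  · classical
    have h := hf (S.indicator 1)
    have hcast : (fun v => ((S.indicator (1 : V → ℤ) v : ℤ) : ℝ)) = S.indicator 1 := by
      ext v
      by_cases hv : v ∈ S <;> simp [hv]
    rw [hcast, dirichlet_sub_self] at h
    have h1 : G.dirichlet (S.indicator 1) (S.indicator 1) = (1 / 2 : ℝ) *
        ∑ e, |S.indicator (1 : V → ℝ) (G.head e) - S.indicator 1 (G.tail e)| := by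
      rw [dirichlet]
      congr 1
      refine Finset.sum_congr rfl fun e _ => ?_
      by_cases h1 : G.head e ∈ S <;> by_cases h2 : G.tail e ∈ S <;> simp [h1, h2]
    linarith

/-- Every function on the vertices is nondecreasing along some acyclic orientation. -/
theorem exists_isAcyclicOrientation_monotone [Fintype V] (f : V → ℝ) :
    ∃ D : Finset A, G.IsAcyclicOrientation D ∧ ∀ e ∈ D, f (G.tail e) ≤ f (G.head e) := by
  classical
  -- A numbering of the vertices breaks ties of `f`, giving a strict order along which to orient.
  set κ : V → ℝ ×ₗ Fin (Fintype.card V) := fun v => toLex (f v, Fintype.equivFin V v) with hκ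
  have hinj : Function.Injective κ := fun u v h => by
    exact (Fintype.equivFin V).injective (congrArg (fun p => (ofLex p).2) h)
  refine ⟨Finset.univ.filter fun e => κ (G.tail e) < κ (G.head e), ⟨fun e he => ?_, ?_⟩, ?_⟩
  · simp only [Finset.mem_filter, Finset.mem_univ, true_and, G.tail_bar, G.head_bar, not_lt]
    exact ⟨le_of_lt, fun h => lt_of_le_of_ne h fun h' => he (hinj h').symm⟩
  · intro v hv
    have : ∀ u, Relation.TransGen (fun x y => ∃ e ∈ Finset.univ.filter
        fun e => κ (G.tail e) < κ (G.head e), G.tail e = x ∧ G.head e = y) v u → κ v < κ u := by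
      intro u hu
      induction hu with
      | single h =>
        obtain ⟨e, he, rfl, rfl⟩ := h
        exact (Finset.mem_filter.1 he).2
      | tail _ h ih =>
        obtain ⟨e, he, rfl, rfl⟩ := h
        exact ih.trans (Finset.mem_filter.1 he).2
    exact lt_irrefl _ (this v hv)
  · intro e he
    have h := (Finset.mem_filter.1 he).2
    rcases (Prod.Lex.toLex_lt_toLex).1 h with h | h
    · exact h.le
    · exact h.1.le

/-- A point of the Voronoi cell is at most as long as some `d f_D`. -/
theorem exists_dirichlet_self_le_energy [Fintype V] [DecidableEq V] {f : V → ℝ}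
    (hf : ∀ n : V → ℤ, G.dirichlet f f ≤
      G.dirichlet (f - fun v => (n v : ℝ)) (f - fun v => (n v : ℝ))) :
    ∃ D h, G.IsAcyclicOrientation D ∧ G.IsPotential D h ∧ G.dirichlet f f ≤ G.energy h := by
  obtain ⟨D, hD, hmono⟩ := G.exists_isAcyclicOrientation_monotone f
  obtain ⟨h, hh⟩ := G.exists_isPotential D
  refine ⟨D, h, hD, hh, ?_⟩
  have h1 := G.two_mul_dirichlet_self_le hf
  have h2 := hD.sum_eq G (w := fun e => |f (G.head e) - f (G.tail e)|)
    (fun e => by simp only [G.head_bar, G.tail_bar, abs_sub_comm]) (fun e he => by simp [he])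
  have h3 : ∑ e ∈ D, |f (G.head e) - f (G.tail e)| = ∑ e ∈ D, (f (G.head e) - f (G.tail e)) :=
    Finset.sum_congr rfl fun e he => abs_of_nonneg (sub_nonneg.2 (hmono e he))
  have h4 := hh.dirichlet_eq G f
  -- Stands in for Cauchy–Schwarz: `q(df) ≤ ⟨dh, df⟩` now gives `q(df) ≤ q(dh)`.
  have h5 := G.dirichlet_self_nonneg (h - f)
  rw [dirichlet_sub_self] at h5
  rw [energy_eq_dirichlet]
  linarith

/-! ### Closest lattice points and the covering number -/

/-- Every function on the vertices has an integral function closest to it. -/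
theorem exists_closest (f : V → ℝ) : ∃ n : V → ℤ, ∀ n' : V → ℤ,
    G.dirichlet (f - fun v => (n v : ℝ)) (f - fun v => (n v : ℝ)) ≤
      G.dirichlet (f - fun v => (n' v : ℝ)) (f - fun v => (n' v : ℝ)) := by
  classical
  set Q : (V → ℤ) → ℝ := fun n => G.dirichlet (f - fun v => (n v : ℝ)) (f - fun v => (n v : ℝ))
    with hQ
  set δ : (V → ℤ) → A → ℤ := fun n e => n (G.head e) - n (G.tail e) with hδ
  -- Adding constants to `n` leaves `Q` unchanged, so finiteness is sought for the differentials
  -- only.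
  have hfin : (δ '' {n | Q n ≤ Q 0}).Finite := by
    set R : ℝ := 2 * Q 0 + 1
    refine (Set.finite_Icc (fun e => ⌊f (G.head e) - f (G.tail e) - R⌋)
      (fun e => ⌈f (G.head e) - f (G.tail e) + R⌉)).subset ?_
    rintro _ ⟨n, hn, rfl⟩
    have hb : ∀ e, |f (G.head e) - f (G.tail e) - δ n e| ≤ R := by
      intro e
      have h1 : (f (G.head e) - f (G.tail e) - δ n e) ^ 2 ≤ 2 * Q n := by
        have := Finset.single_le_sum (f := fun e => (f (G.head e) - f (G.tail e) - δ n e) ^ 2)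
          (fun e _ => sq_nonneg _) (Finset.mem_univ e)
        refine this.trans (le_of_eq ?_)
        simp only [hQ, dirichlet, hδ, Pi.sub_apply, Int.cast_sub]
        rw [← mul_assoc]
        norm_num
        exact Finset.sum_congr rfl fun e _ => by ring
      have hn' : Q n ≤ Q 0 := hn
      rw [← sq_abs] at h1
      nlinarith [sq_nonneg (|f (G.head e) - f (G.tail e) - δ n e| - 1),
        abs_nonneg (f (G.head e) - f (G.tail e) - δ n e)]
    refine ⟨fun e => Int.floor_le_iff.2 ?_, fun e => Int.le_ceil_iff.2 ?_⟩
    · have := (abs_le.1 (hb e)).2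
      linarith
    · have := (abs_le.1 (hb e)).1
      linarith
  have hfactor : ∀ n n', δ n = δ n' → Q n = Q n' := by
    intro n n' h
    simp only [hQ, dirichlet]
    congr 1
    refine Finset.sum_congr rfl fun e _ => ?_
    have he : (n (G.head e) : ℝ) - n (G.tail e) = n' (G.head e) - n' (G.tail e) := by
      exact_mod_cast congrFun h e
    have h1 : f (G.head e) - n (G.head e) - (f (G.tail e) - n (G.tail e)) =
        f (G.head e) - n' (G.head e) - (f (G.tail e) - n' (G.tail e)) := by linarith
    simp only [Pi.sub_apply, h1]
  have hfinQ : (Q '' {n | Q n ≤ Q 0}).Finite := by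
    -- `Q` factors through `δ`; the default `0` is never reached on the image.
    refine (hfin.image fun x => if h : ∃ n, δ n = x then Q h.choose else 0).subset ?_
    rintro _ ⟨n, hn, rfl⟩
    refine ⟨δ n, ⟨n, hn, rfl⟩, ?_⟩
    have h : ∃ n', δ n' = δ n := ⟨n, rfl⟩
    simp only [h, dif_pos]
    exact hfactor _ _ h.choose_spec
  obtain ⟨_, ⟨n, hn, rfl⟩, hmin⟩ := Set.exists_min_image _ id hfinQ ⟨Q 0, 0, le_refl (Q 0), rfl⟩
  refine ⟨n, fun n' => ?_⟩
  by_cases h : Q n' ≤ Q 0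
  · exact hmin _ ⟨n', h, rfl⟩
  · exact le_trans hn (not_le.1 h).le

theorem exists_isWellUnbalanced [Fintype V] [DecidableEq V] : ∃ D, G.IsWellUnbalanced D := by
  classical
  choose F hF using G.exists_isPotential
  obtain ⟨D₀, hD₀, -⟩ := G.exists_isAcyclicOrientation_monotone 0
  obtain ⟨D, hD, hmax⟩ := Set.exists_max_image {D | G.IsAcyclicOrientation D}
    (fun D => G.energy (F D)) (Set.toFinite _) ⟨D₀, hD₀⟩
  refine ⟨D, hD, F D, hF D, fun D' f' hD' hf' => ?_⟩
  rw [G.energy_eq_of_isPotential hf' (hF D')]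
  exact hmax D' hD'

theorem cutForm_apply (x : G.cutSpace) {f : V → ℝ} (hf : x.1 = G.d ℝ f) :
    G.cutForm x = G.dirichlet f f := by
  change (1 / 2 : ℝ) * ∑ e, x.1.1 e * x.1.1 e = _
  rw [hf]
  rfl

theorem isCoveringNumber_iff (r : ℝ) :
    IsCoveringNumber G.cutForm G.cutLattice r ↔ IsLeast {r : ℝ | ∀ f : V → ℝ, ∃ n : V → ℤ,
      G.dirichlet (f - fun v => (n v : ℝ)) (f - fun v => (n v : ℝ)) ≤ r} r := by
  have h : {r : ℝ | ∀ x : G.cutSpace, ∃ m ∈ G.cutLattice, G.cutForm (x - m) ≤ r} =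
      {r : ℝ | ∀ f : V → ℝ, ∃ n : V → ℤ,
        G.dirichlet (f - fun v => (n v : ℝ)) (f - fun v => (n v : ℝ)) ≤ r} := by
    ext s
    constructor
    · intro hs f
      obtain ⟨m, hm, hle⟩ := hs ⟨G.d ℝ f, f, rfl⟩
      obtain ⟨n, hn⟩ := G.mem_cutLattice.1 hm
      refine ⟨n, ?_⟩
      rwa [G.cutForm_apply _ (f := f - fun v => (n v : ℝ))] at hle
      rw [Submodule.coe_sub, hn, map_sub]
    · rintro hs ⟨_, f, rfl⟩
      obtain ⟨n, hn⟩ := hs f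
      refine ⟨⟨G.d ℝ fun v => (n v : ℝ), _, rfl⟩, G.mem_cutLattice.2 ⟨n, rfl⟩, ?_⟩
      rwa [G.cutForm_apply _ (f := f - fun v => (n v : ℝ))]
      rw [Submodule.coe_sub, map_sub]
  rw [IsCoveringNumber, h]

/-- The covering number is the energy of a well-unbalanced orientation. -/
theorem IsWellUnbalanced.isCoveringNumber [Fintype V] [DecidableEq V] {D : Finset A}
    (hD : G.IsWellUnbalanced D) {f : V → ℝ} (hf : G.IsPotential D f) :
    IsCoveringNumber G.cutForm G.cutLattice (G.energy f) := by
  obtain ⟨hac, f₀, hf₀, hmax⟩ := hD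
  rw [isCoveringNumber_iff, G.energy_eq_of_isPotential hf hf₀]
  constructor
  · intro g
    obtain ⟨n, hn⟩ := G.exists_closest g
    refine ⟨n, ?_⟩
    obtain ⟨D', h, hD', hh, hle⟩ := G.exists_dirichlet_self_le_energy
      (f := g - fun v => (n v : ℝ)) fun n' => by
        -- Translating by the closest point `n` moves `g` into the Voronoi cell of the origin.
        have := hn (n + n')
        simp only [Pi.add_apply, Int.cast_add] at this
        rwa [sub_sub]
    exact hle.trans (hmax D' h hD' hh)
  · intro s hs
    obtain ⟨n, hn⟩ := hs f₀
    rw [energy_eq_dirichlet]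
    exact (hf₀.dirichlet_self_le G hac n).trans hn

/-! ### Bipartite graphs -/

theorem card_eq_two_mul_numEdges : Fintype.card A = 2 * G.numEdges := by
  classical
  have himg : G.numEdges = (Finset.univ.image fun e => s(e, G.bar e)).card := by
    rw [numEdges, ← Set.ncard_coe_finset]
    simp
  rw [himg, mul_comm, ← Finset.card_univ]
  refine Finset.card_eq_sum_card_image (fun e => s(e, G.bar e)) Finset.univ |>.trans ?_
  refine Finset.sum_const_nat fun p hp => ?_
  obtain ⟨e, -, rfl⟩ := Finset.mem_image.1 hp
  have : ({a ∈ Finset.univ | s(a, G.bar a) = s(e, G.bar e)} : Finset A) = {e, G.bar e} := by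
    ext a
    simp only [Finset.mem_filter, Finset.mem_univ, true_and, Sym2.eq_iff, Finset.mem_insert,
      Finset.mem_singleton]
    constructor
    · rintro (h | h)
      · exact Or.inl h.1
      · exact Or.inr h.1
    · rintro (rfl | rfl)
      · exact Or.inl ⟨rfl, rfl⟩
      · exact Or.inr ⟨rfl, G.bar_bar e⟩
  rw [this, Finset.card_pair (G.bar_ne e).symm]

/-- No potential of an orientation of a graph without loops has energy above a quarter of the
number of edges. -/
theorem IsPotential.energy_le [Fintype V] [DecidableEq V] {D : Finset A} {f : V → ℝ}
    (hf : G.IsPotential D f) (hD : G.IsAcyclicOrientation D)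
    (hloop : ∀ e, G.tail e ≠ G.head e) : G.energy f ≤ (G.numEdges : ℝ) / 4 := by
  have h1 := hf.dirichlet_eq G f
  have h2 := hD.dirichlet_self_eq G f
  have h3 := hD.sum_eq G (w := fun _ => 1) (fun _ => rfl) (fun e he => (hloop e he).elim)
  -- From `t ≤ t² + 1/4`: the left sum is twice the energy, the squares sum to the energy.
  have h4 : ∑ e ∈ D, (f (G.head e) - f (G.tail e)) ≤
      ∑ e ∈ D, ((f (G.head e) - f (G.tail e)) ^ 2 + (1 / 4) * 1) :=
    Finset.sum_le_sum fun e _ => by nlinarith [sq_nonneg (f (G.head e) - f (G.tail e) - 1 / 2)]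
  rw [Finset.sum_add_distrib, ← Finset.mul_sum] at h4
  have h5 : ∑ _e : A, (1 : ℝ) = 2 * G.numEdges := by
    rw [Finset.sum_const, Finset.card_univ, G.card_eq_two_mul_numEdges]
    simp
  rw [energy_eq_dirichlet]
  linarith

/-- For a bipartite graph, orienting all edges from one class to the other is well-unbalanced. -/
theorem Bipartite.exists_isWellUnbalanced [Fintype V] [DecidableEq V] (hG : G.Bipartite) :
    ∃ D f, G.IsWellUnbalanced D ∧ G.IsPotential D f ∧ G.energy f = (G.numEdges : ℝ) / 4 := by
  classical
  obtain ⟨X, hX⟩ := hG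
  have hloop : ∀ e, G.tail e ≠ G.head e := fun e he => by
    have := hX e
    rw [he] at this
    exact iff_not_self this
  set D : Finset A := Finset.univ.filter fun e => G.tail e ∈ X with hDdef
  have hmem : ∀ e, e ∈ D ↔ G.tail e ∈ X := fun e => by simp [hDdef]
  have hD : G.IsAcyclicOrientation D := by
    refine ⟨fun e _ => ?_, fun v hv => ?_⟩
    · rw [hmem, hmem, G.tail_bar, hX e, not_not]
    · have : ∀ u, Relation.TransGen (fun x y => ∃ e ∈ D, G.tail e = x ∧ G.head e = y) v u →
          v ∈ X ∧ u ∉ X := by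
        intro u hu
        induction hu with
        | single h =>
          obtain ⟨e, he, rfl, rfl⟩ := h
          exact ⟨(hmem e).1 he, (hX e).1 ((hmem e).1 he)⟩
        | tail _ h ih =>
          obtain ⟨e, he, rfl, rfl⟩ := h
          exact ⟨ih.1, (hX e).1 ((hmem e).1 he)⟩
      exact (this v hv).2 (this v hv).1
  obtain ⟨f, hf⟩ := G.exists_isPotential D
  -- Here half the indicator of `D` is itself a cut, namely `dh`; `q(df - dh) ≥ 0` then forces
  -- equality in the upper bound.
  set h : V → ℝ := fun v => if v ∈ X then -(1 / 4) else 1 / 4 with hh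
  have hdh : ∀ e ∈ D, h (G.head e) - h (G.tail e) = 1 / 2 := fun e he => by
    have h1 := (hmem e).1 he
    have h2 := (hX e).1 h1
    simp only [hh, h1, h2, if_true, if_false]
    norm_num
  have hcard : (D.card : ℝ) = G.numEdges := by
    have h3 := hD.sum_eq G (w := fun _ => 1) (fun _ => rfl) (fun e he => (hloop e he).elim)
    rw [Finset.sum_const, Finset.sum_const, Finset.card_univ, G.card_eq_two_mul_numEdges] at h3
    simpa using h3.symm
  have hfh := hf.dirichlet_eq G h
  rw [Finset.sum_congr rfl hdh, Finset.sum_const, nsmul_eq_mul, hcard] at hfh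
  have hhh := hD.dirichlet_self_eq G h
  rw [Finset.sum_congr rfl fun e he => by rw [hdh e he], Finset.sum_const, nsmul_eq_mul,
    hcard] at hhh
  have hsub := G.dirichlet_self_nonneg (f - h)
  rw [dirichlet_sub_self] at hsub
  have hE : G.energy f = (G.numEdges : ℝ) / 4 := by
    refine le_antisymm (hf.energy_le G hD hloop) ?_
    rw [energy_eq_dirichlet]
    linarith
  refine ⟨D, f, ⟨hD, f, hf, fun D' f' hD' hf' => ?_⟩, hf, hE⟩
  rw [hE]
  exact hf'.energy_le G hD' hloop

end Pairing

end OrGraph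

theorem mainTheorem9 {V A : Type*} [Fintype V] [Fintype A] [DecidableEq V]
    (G : OrGraph V A) (hG : G.Connected) :
    (∀ D : Finset A, G.IsAcyclicOrientation D →
      (∃ f : V → ℝ, G.IsPotential D f) ∧
      ∀ f f' : V → ℝ, G.IsPotential D f → G.IsPotential D f' → G.energy f = G.energy f') ∧
    (∃ D : Finset A, G.IsWellUnbalanced D) ∧
    (∀ D : Finset A, G.IsWellUnbalanced D → ∀ f : V → ℝ, G.IsPotential D f →
      IsCoveringNumber G.cutForm G.cutLattice (G.energy f)) ∧
    (G.Bipartite → IsCoveringNumber G.cutForm G.cutLattice ((G.numEdges : ℝ) / 4)) := by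
  refine ⟨fun D _ => ⟨G.exists_isPotential D, fun _ _ => G.energy_eq_of_isPotential⟩,
    G.exists_isWellUnbalanced, fun D hD f hf => hD.isCoveringNumber G hf, fun hB => ?_⟩
  obtain ⟨D, f, hD, hf, hE⟩ := OrGraph.Bipartite.exists_isWellUnbalanced G hB
  rw [← hE]
  exact hD.isCoveringNumber G hf
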